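/- Let $a \ge 1$, $i \in \{-1, 1\}$ and $n = 4a+6+i$. Define permutations $s$ and $t$ as follows (permutations act on the right, products are read from left to right). If $i=-1$, on the $4a+7$ points $1,\dots,2a,\,1',\dots,(2a)',\,\alpha,\alpha',\beta,\beta',\gamma,\delta,\epsilon$ let $$s = (1,2,\dots,2a,\alpha,\beta,\gamma,(2a)',(2a-1)',\dots,1',\delta,\epsilon), \qquad t = (\alpha,\alpha')(\beta,\beta')\prod_{j=1}^{2a}(j,j').$$ If $i=1$, on the $4a+8$ points $1,\dots,2a,\,1',\dots,(2a)',\,\alpha,\alpha',\beta,\beta',\gamma,\gamma',\delta,\delta'$ let $$s = (1,2,\dots,2a,\alpha,\beta,\beta',\gamma,\delta,\gamma',\alpha',(2a)',(2a-1)',\dots,1'), \qquad t = (\alpha,\alpha')(\beta,\beta')(\gamma,\gamma')(\delta,\delta')\prod_{j=1}^{2a}(j,j').$$ Let $r = t s^{-1}$, so that $rs = t$, let $G = \langle r, s\rangle$, and let $k$ be the number of points. Then $k = n+2$ if $i=-1$ and $k=n+1$ if $i=1$, the group $G$ is the alternating group $A_k$ on these points, and $\mathcal{M}(G:r,s)$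 is a chiral map of type $\{6,n\}$. Here $\mathcal{M}(G:r,s)$ is the orientably-regular map whose arcs are identified with the elements of $G$, with $r$ and $s$ the one-step rotations about a face and an incident vertex and $rs$ the involution reversing the corresponding arc. Type $\{6,n\}$ means that all faces have length $6$ and all vertices have valency $n$ (that is, $r$ has order $6$ and $s$ has order $n$). Chiral means that the map has no orientation-reversing automorphism (that is, no automorphism of $G$ sends $r$ to $r^{-1}$ and $s$ to $s^{-1}$). -/

import Mathlib

open Equiv

/-- The combinatorial data of a map on an oriented surface: `D` is the set of arcs (directed edges),
`rot` sends an arc to the next arc, in the positive sense, around the same initial vertex,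
and `rev` sends an arc to the same edge directed the other way. -/
structure ArcSystem (D : Type*) where
  rot : Perm D
  rev : Perm D

namespace ArcSystem

variable {D : Type*} (M : ArcSystem D)

/-- The data describe a map, that is, a cellular embedding of a connected graph in an oriented
surface: `rev` is an involution without fixed points, and the graph is connected, which means that
`rot` and `rev` generate a transitive group on the arcs. -/
def IsMap : Prop :=
  (∀ d, M.rev (M.rev d) = d) ∧ (∀ d, M.rev d ≠ d) ∧
    MulAction.IsPretransitive (Subgroup.closure {M.rot, M.rev}) D

/-- The permutation whose cycles are the boundary walks of the faces: an arc from `u` to `v` goes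
to the arc into `u` that precedes it on the boundary of the face lying to its right. -/
def face : Perm D := M.rev * M.rot⁻¹

/-- Type `{m, n}`: every face has length `m` and every vertex has valency `n`. -/
def HasType (m n : ℕ) : Prop :=
  ∀ d, Function.minimalPeriod M.face d = m ∧ Function.minimalPeriod M.rot d = n

/-- The orientation-preserving automorphisms, as permutations of the arcs. -/
def aut : Subgroup (Perm D) := Subgroup.centralizer {M.rot, M.rev}

/-- Orientably-regular: the orientation-preserving automorphisms are transitive on the arcs. -/
def IsOrientablyRegular : Prop := M.IsMap ∧ MulAction.IsPretransitive M.aut D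

/-- There is an orientation-reversing automorphism. -/
def IsReflexible : Prop :=
  ∃ f : Perm D, (∀ d, f (M.rot d) = M.rot⁻¹ (f d)) ∧ ∀ d, f (M.rev d) = M.rev (f d)

/-- Orientably-regular and not reflexible. -/
def IsChiral : Prop := M.IsOrientablyRegular ∧ ¬ M.IsReflexible

end ArcSystem

/-- The map `M(G : r, s)`. Fix an arc `e` at a vertex `u` and let `s` and `r` be the one-step
rotations about `u` and about the face to the right of `e`. Products of permutations are composed
from right to left here, so `s * r` (first `r`, then `s`) is the half-turn that reverses `e`.
The arc `g e` is recorded as the group element `g`; the next arc around its initial vertex is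
`g s e`, its reverse is `g (s * r) e`, and its `face` image is `g r e`.
The group `G` acts on the arcs by multiplication on the left. -/
def regularMap {G : Type*} [Group G] (r s : G) : ArcSystem G where
  rot := Equiv.mulRight s
  rev := Equiv.mulRight (s * r)

/-- If `r` and `s` generate `G` and `s * r` is an involution, the map is reflexible exactly when
some automorphism of the group `G` inverts both generators. -/
theorem regularMap_isReflexible_iff {G : Type*} [Group G] (r s : G)
    (hgen : Subgroup.closure {r, s} = ⊤) (hinv : (s * r) * (s * r) = 1) :
    (regularMap r s).IsReflexible ↔ ∃ φ : G ≃* G, φ r = r⁻¹ ∧ φ s = s⁻¹ := by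
  constructor
  · rintro ⟨f, h1, h2⟩
    have h1' : ∀ d, f (d * s) = f d * s⁻¹ := fun d => by
      simpa [regularMap] using h1 d
    have h2' : ∀ d, f (d * (s * r)) = f d * (s * r) := h2
    have key : ∀ x d, f (d * x) = f d * ((f 1)⁻¹ * f x) := by
      have : ∀ x ∈ Subgroup.closure ({r, s} : Set G), ∀ d, f (d * x) = f d * ((f 1)⁻¹ * f x) := by
        intro x hx
        have hs : ∀ d, f (d * s) = f d * ((f 1)⁻¹ * f s) := fun d => by
          have := h1' 1
          rw [one_mul] at this
          rw [h1', this]; group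
        have hr0 : ∀ d, f (d * r) = f d * (s * (s * r)) := fun d => by
          have a1 := h2' (d * s⁻¹)
          have a2 := h1' (d * s⁻¹)
          simp only [inv_mul_cancel_right] at a2
          rw [show d * s⁻¹ * (s * r) = d * r by group] at a1
          rw [a1, a2]; group
        have hr : ∀ d, f (d * r) = f d * ((f 1)⁻¹ * f r) := fun d => by
          have := hr0 1
          rw [one_mul] at this
          rw [hr0, this]; group
        induction hx using Subgroup.closure_induction with
        | mem x hx =>
          rcases hx with rfl | rfl
          · exact hr
          · exact hs
        | one => intro d; simp
        | mul x y _ _ ihx ihy =>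
          intro d
          rw [← mul_assoc, ihy, ihx, ihy x]; group
        | inv x _ ih =>
          intro d
          have a1 := ih (d * x⁻¹)
          have a2 := ih x⁻¹
          simp only [inv_mul_cancel_right, inv_mul_cancel] at a1 a2
          have a3 : (f 1)⁻¹ * f x = (f x⁻¹)⁻¹ * f 1 := by
            rw [eq_inv_mul_iff_mul_eq, ← a2]
          rw [a1, a3]; group
      exact fun x => this x (hgen ▸ Subgroup.mem_top x)
    have hs1 : f s = f 1 * s⁻¹ := by simpa using h1' 1
    have hr1 : f r = f 1 * (s * (s * r)) := by
      have a1 := h2' s⁻¹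
      have a2 := h1' s⁻¹
      rw [inv_mul_cancel_left] at a1
      rw [inv_mul_cancel] at a2
      rw [a1, a2]; group
    refine ⟨⟨f.trans ((Equiv.mulLeft (s⁻¹ * (f 1)⁻¹)).trans (Equiv.mulRight s)),
      fun x y => ?_⟩, ?_, ?_⟩
    · change s⁻¹ * (f 1)⁻¹ * f (x * y) * s =
        s⁻¹ * (f 1)⁻¹ * f x * s * (s⁻¹ * (f 1)⁻¹ * f y * s)
      rw [key y x]; group
    · change s⁻¹ * (f 1)⁻¹ * f r * s = r⁻¹
      rw [hr1, eq_comm, inv_eq_iff_mul_eq_one]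
      calc r * (s⁻¹ * (f 1)⁻¹ * (f 1 * (s * (s * r))) * s) = s⁻¹ * (s * r * (s * r)) * s := by group
        _ = 1 := by rw [hinv]; group
    · change s⁻¹ * (f 1)⁻¹ * f s * s = s⁻¹
      rw [hs1]; group
  · rintro ⟨φ, h1, h2⟩
    refine ⟨φ.toEquiv.trans (Equiv.mulRight s⁻¹), fun d => ?_, fun d => ?_⟩
    · simp [regularMap, h2]
    · have e : s⁻¹ * r⁻¹ * s⁻¹ = r := by
        calc s⁻¹ * r⁻¹ * s⁻¹ = r * (s * r * (s * r))⁻¹ := by group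
          _ = r := by rw [hinv]; simp
      change φ (d * (s * r)) * s⁻¹ = φ d * s⁻¹ * (s * r)
      rw [map_mul, map_mul, h1, h2, mul_assoc, e]; group

section Construction

variable {X : Type*}

/-- The permutation `r` determined by: first `r`, then `s`, is `t`. -/
def rPerm (s t : Perm X) : Perm X := s⁻¹ * t

/-- The group `G` generated by `r` and `s`. -/
def genGroup (s t : Perm X) : Subgroup (Perm X) := Subgroup.closure {rPerm s t, s}

/-- The map `M(G : r, s)` given by the permutations `s` and `t`. -/
def permMap (s t : Perm X) : ArcSystem (genGroup s t) :=
  regularMap ⟨rPerm s t, Subgroup.subset_closure (Or.inl rfl)⟩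
    ⟨s, Subgroup.subset_closure (Or.inr rfl)⟩

end Construction

/-- The points of the construction with `i = -1`. The points `1, …, 2a` are `num j`, and the points
`1', …, (2a)'` are `num' j`, where the index `j` in `Fin (2 * a)` counts from `0`. -/
inductive PointNeg (a : ℕ) : Type
  | num (j : Fin (2 * a))
  | num' (j : Fin (2 * a))
  | α | α' | β | β' | γ | δ | ε
  deriving DecidableEq, Fintype

/-- The points of the construction with `i = 1`, in the same notation. -/
inductive PointPos (a : ℕ) : Type
  | num (j : Fin (2 * a))
  | num' (j : Fin (2 * a))
  | α | α' | β | β' | γ | γ' | δ | δ'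
  deriving DecidableEq, Fintype

namespace PointNeg

/-- The cycle `(1, 2, …, 2a, α, β, γ, (2a)', …, 2', 1', δ, ε)`. -/
def s (a : ℕ) : Perm (PointNeg a) :=
  (List.ofFn num ++ [α, β, γ] ++ (List.ofFn num').reverse ++ [δ, ε]).formPerm

/-- The involution `(α, α')(β, β') ∏ (j, j')`. -/
def t (a : ℕ) : Perm (PointNeg a) :=
  swap α α' * swap β β' * (List.ofFn fun j => swap (num j) (num' j)).prod

end PointNeg

namespace PointPos

/-- The cycle `(1, 2, …, 2a, α, β, β', γ, δ, γ', α', (2a)', …, 2', 1')`. -/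
def s (a : ℕ) : Perm (PointPos a) :=
  (List.ofFn num ++ [α, β, β', γ, δ, γ', α'] ++ (List.ofFn num').reverse).formPerm

/-- The involution `(α, α')(β, β')(γ, γ')(δ, δ') ∏ (j, j')`. -/
def t (a : ℕ) : Perm (PointPos a) :=
  swap α α' * swap β β' * (swap γ γ' * swap δ δ') *
    (List.ofFn fun j => swap (num j) (num' j)).prod

end PointPos

/-!
The group `G` is identified by Jordan's theorem: a primitive permutation group that contains a
3-cycle contains the alternating group. Both generators are even. The permutation `s` is a single
cycle with at most two fixed points, which makes primitivity easy (`isPreprimitive_genGroup`): a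
block through a fixed point of `s` is stabilized by `s`, hence contains either no point or every
point of the long cycle.

Everything else rests on one observation. The face rotation `r` exchanges `j` and `(j + 1)'` for
most `j`, so `r ^ 2` is a product of two or three 3-cycles on points at the ends of the ladder formed
by the pairs `j, j'`. Conjugates of `r ^ 2` by short words in `r` and `s` are again products of
3-cycles on explicitly known points, whatever `a` is, and so a product of a few of them is the image
of a permutation of `Fin 9`, `Fin 11` or `Fin 13` under the embedding that lists these points
(`viaEmbedding_cyc3`). Identities between such products are then finite checks (for `i = -1` and
`a = 1` some of the points coincide, and the relator is evaluated directly). They show that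
`r ^ 2` has order 3 and that `G` contains a 3-cycle, and they prove chirality.

For chirality no information on the automorphisms of the alternating group is needed. An automorphism
inverting `r` and `s` maps a word in `(r, s)` to the same word in `(r⁻¹, s⁻¹)`, so it suffices to give
a word that is trivial at `(r, s)` and not at `(r⁻¹, s⁻¹)` (`permMap_hasType_isChiral`). The words are
`PointNeg.relator` and `PointPos.relator`; each is the cube of a product of three conjugates of
`r ^ 2` and its inverse.
-/

open scoped Pointwise

/-! ### 3-cycles and their transfer along embeddings -/

section ThreeCycles

variable {X Y : Type*} [DecidableEq X] [DecidableEq Y]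

/-- The permutation `x ↦ y ↦ z ↦ x`, a 3-cycle when `x`, `y`, `z` are distinct. -/
def cyc3 (x y z : X) : Perm X := swap x y * swap y z

theorem conj_cyc3 (g : Perm X) (x y z : X) :
    g * cyc3 x y z * g⁻¹ = cyc3 (g x) (g y) (g z) := by
  simp only [cyc3, swap_apply_apply]; group

theorem viaEmbedding_cyc3 (f : Y ↪ X) (x y z : Y) :
    Perm.viaEmbeddingHom f (cyc3 x y z) = cyc3 (f x) (f y) (f z) := by
  have key (u v : Y) : Perm.viaEmbeddingHom f (swap u v) = swap (f u) (f v) := by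
    ext p
    rw [Perm.viaEmbeddingHom_apply]
    by_cases hp : p ∈ Set.range f
    · obtain ⟨q, rfl⟩ := hp
      rw [Perm.viaEmbedding_apply, f.injective.swap_apply]
    · rw [Perm.viaEmbedding_apply_of_notMem _ _ _ hp, swap_apply_of_ne_of_ne]
      · rintro rfl; exact hp ⟨u, rfl⟩
      · rintro rfl; exact hp ⟨v, rfl⟩
  simp only [cyc3, map_mul, key]

theorem isThreeCycle_cyc3 [Fintype X] {x y z : X} (h1 : x ≠ y) (h2 : x ≠ z) (h3 : y ≠ z) :
    (cyc3 x y z).IsThreeCycle := by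
  rw [cyc3, swap_comm x y]
  exact Perm.isThreeCycle_swap_mul_swap_same h1.symm h3 h2

end ThreeCycles

/-! ### Products of disjoint transpositions -/

section SwapProduct

variable {X : Type*} [DecidableEq X]

theorem prod_swap_apply_of_ne {m : ℕ} (f g : Fin m → X) (x : X) (hf : ∀ j, x ≠ f j)
    (hg : ∀ j, x ≠ g j) : (List.ofFn fun j => swap (f j) (g j)).prod x = x := by
  induction m with
  | zero => simp
  | succ m ih =>
    rw [List.ofFn_succ, List.prod_cons, Perm.mul_apply,
      ih (fun j => f j.succ) (fun j => g j.succ) (fun j => hf _) fun j => hg _,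
      swap_apply_of_ne_of_ne (hf _) (hg _)]

theorem prod_swap_apply {m : ℕ} (f g : Fin m → X) (hf : f.Injective) (hg : g.Injective)
    (hfg : ∀ i j, f i ≠ g j) (i : Fin m) :
    (List.ofFn fun j => swap (f j) (g j)).prod (f i) = g i ∧
      (List.ofFn fun j => swap (f j) (g j)).prod (g i) = f i := by
  induction m with
  | zero => exact i.elim0
  | succ m ih =>
    simp only [List.ofFn_succ, List.prod_cons, Perm.mul_apply]
    refine Fin.cases ?_ (fun i => ?_) i
    · rw [prod_swap_apply_of_ne, prod_swap_apply_of_ne]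
      · simp
      · exact fun j => (hfg _ _).symm
      · exact fun j => hg.ne (Fin.succ_ne_zero j).symm
      · exact fun j => hf.ne (Fin.succ_ne_zero j).symm
      · exact fun j => hfg _ _
    · obtain ⟨h1, h2⟩ := ih (fun j => f j.succ) (fun j => g j.succ)
        (hf.comp (Fin.succ_injective m)) (hg.comp (Fin.succ_injective m)) (fun i j => hfg _ _) i
      rw [h1, h2]
      exact ⟨swap_apply_of_ne_of_ne (hfg _ _).symm (hg.ne (Fin.succ_ne_zero i)),
        swap_apply_of_ne_of_ne (hf.ne (Fin.succ_ne_zero i)) (hfg _ _)⟩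

theorem sign_prod_swap [Fintype X] {m : ℕ} (f g : Fin m → X) (hfg : ∀ i, f i ≠ g i) :
    Perm.sign (List.ofFn fun j => swap (f j) (g j)).prod = (-1) ^ m := by
  rw [map_list_prod, List.map_ofFn]
  have : (⇑Perm.sign ∘ fun j => swap (f j) (g j)) = fun _ => (-1 : ℤˣ) := by
    funext j; simp [hfg]
  rw [this, List.prod_ofFn]; simp

end SwapProduct

/-! ### The group and the map given by two permutations -/

section PermMap

variable {X : Type*} {s t : Perm X}

theorem rPerm_mem_genGroup : rPerm s t ∈ genGroup s t := Subgroup.subset_closure (Or.inl rfl)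

theorem s_mem_genGroup : s ∈ genGroup s t := Subgroup.subset_closure (Or.inr rfl)

theorem t_mem_genGroup : t ∈ genGroup s t := by
  have := mul_mem (s_mem_genGroup (s := s) (t := t)) (rPerm_mem_genGroup (s := s) (t := t))
  rwa [rPerm, mul_inv_cancel_left] at this

theorem genGroup_le_alternatingGroup [Fintype X] [DecidableEq X] (hs : Perm.sign s = 1)
    (ht : Perm.sign t = 1) : genGroup s t ≤ alternatingGroup X := by
  rw [genGroup, Subgroup.closure_le]
  rintro g (rfl | rfl) <;> simp [Perm.mem_alternatingGroup, rPerm, hs, ht]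

/-- The type is given by the orders of the generators, and chirality is witnessed by a relation `w`
that breaks when both generators are inverted: an automorphism of `G` inverting the generators would
preserve it. -/
theorem permMap_hasType_isChiral {n : ℕ} (ht : t * t = 1) (ht' : t ≠ 1)
    (hr : orderOf (rPerm s t) = 6) (hs : orderOf s = n) (w : FreeGroup (Fin 2))
    (hw : FreeGroup.lift ![rPerm s t, s] w = 1)
    (hw' : FreeGroup.lift ![(rPerm s t)⁻¹, s⁻¹] w ≠ 1) :
    (permMap s t).HasType 6 n ∧ (permMap s t).IsChiral := by
  obtain ⟨ρ, hρ⟩ : ∃ ρ : genGroup s t, ρ = ⟨rPerm s t, rPerm_mem_genGroup⟩ := ⟨_, rfl⟩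
  obtain ⟨σ, hσ⟩ : ∃ σ : genGroup s t, σ = ⟨s, s_mem_genGroup⟩ := ⟨_, rfl⟩
  have hM : permMap s t = regularMap ρ σ := by rw [hρ, hσ]; rfl
  have hστ : ((σ * ρ : genGroup s t) : Perm X) = t := by simp [hρ, hσ, rPerm]
  have hinv : σ * ρ * (σ * ρ) = 1 := by
    apply Subtype.ext; rw [Subgroup.coe_mul, hστ, ht]; rfl
  have hne : σ * ρ ≠ 1 := fun h => ht' (by rw [← hστ, h]; rfl)
  have hgen : Subgroup.closure {ρ, σ} = ⊤ := by
    have := Subgroup.closure_closure_coe_preimage (k := {rPerm s t, s})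
    refine Eq.trans ?_ this
    congr 1
    ext ⟨x, hx⟩
    simp only [hρ, hσ, Set.mem_insert_iff, Set.mem_singleton_iff, Subtype.mk.injEq]
    exact Iff.rfl
  have hperiod (g d : genGroup s t) :
      Function.minimalPeriod (Equiv.mulRight g) d = orderOf (g : Perm X) := by
    rw [Subgroup.orderOf_coe, orderOf]
    have hit (k : ℕ) (x : genGroup s t) : (⇑(Equiv.mulRight g))^[k] x = x * g ^ k := by
      induction k generalizing x with
      | zero => simp
      | succ k ih => rw [Function.iterate_succ_apply, ih, pow_succ']; simp [mul_assoc]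
    apply Function.minimalPeriod_eq_minimalPeriod_iff.2
    intro k
    simp [Function.IsPeriodicPt, Function.IsFixedPt]
  rw [hM]
  refine ⟨fun d => ⟨?_, ?_⟩, ⟨⟨⟨fun d => ?_, fun d h => hne ?_, ⟨fun x y => ?_⟩⟩,
    ⟨fun x y => ?_⟩⟩, ?_⟩⟩
  · -- The conventions for `face` and for `r` agree: `face` is right multiplication by `r`.
    have : (regularMap ρ σ).face = Equiv.mulRight ρ := by
      ext d; simp [ArcSystem.face, regularMap, Perm.mul_apply]
    rw [this, hperiod, hρ, hr]
  · change Function.minimalPeriod (Equiv.mulRight σ) d = n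
    rw [hperiod, hσ, hs]
  · change d * (σ * ρ) * (σ * ρ) = d
    rw [mul_assoc, hinv, mul_one]
  · change d * (σ * ρ) = d at h
    simpa using h
  · -- Right translation by any element lies in the group generated by `rot` and `rev`.
    have key : ∀ g ∈ Subgroup.closure ({ρ, σ} : Set (genGroup s t)),
        Equiv.mulRight g ∈ Subgroup.closure {(regularMap ρ σ).rot, (regularMap ρ σ).rev} := by
      intro g hg
      induction hg using Subgroup.closure_induction with
      | mem g hg =>
        have h1 : Equiv.mulRight σ ∈
            Subgroup.closure {(regularMap ρ σ).rot, (regularMap ρ σ).rev} :=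
          Subgroup.subset_closure (Or.inl rfl)
        have h2 : Equiv.mulRight (σ * ρ) ∈
            Subgroup.closure {(regularMap ρ σ).rot, (regularMap ρ σ).rev} :=
          Subgroup.subset_closure (Or.inr rfl)
        rcases hg with rfl | rfl
        · convert mul_mem h2 (inv_mem h1)
          ext d; simp [Perm.mul_apply]
        · exact h1
      | one =>
        rw [show Equiv.mulRight (1 : genGroup s t) = 1 by ext d; simp]
        exact one_mem _
      | mul x y _ _ hx hy =>
        convert mul_mem hy hx
        ext d; simp [Perm.mul_apply]
      | inv x _ hx =>
        rw [show Equiv.mulRight x⁻¹ = (Equiv.mulRight x)⁻¹ from rfl]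
        exact inv_mem hx
    exact ⟨⟨_, key (x⁻¹ * y) (hgen ▸ Subgroup.mem_top _)⟩, mul_inv_cancel_left x y⟩
  · -- Left translations commute with `rot` and `rev`.
    refine ⟨⟨Equiv.mulLeft (y * x⁻¹), ?_⟩, inv_mul_cancel_right y x⟩
    rw [ArcSystem.aut, Subgroup.mem_centralizer_iff]
    rintro h (rfl | rfl) <;> ext d <;> simp [regularMap, Perm.mul_apply, mul_assoc]
  · rw [regularMap_isReflexible_iff ρ σ hgen hinv]
    rintro ⟨φ, h1, h2⟩
    have e1 : (genGroup s t).subtype.comp (FreeGroup.lift ![ρ, σ]) =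
        FreeGroup.lift ![rPerm s t, s] := by
      ext i; fin_cases i <;> simp [hρ, hσ]
    have e2 : (genGroup s t).subtype.comp (φ.toMonoidHom.comp (FreeGroup.lift ![ρ, σ])) =
        FreeGroup.lift ![(rPerm s t)⁻¹, s⁻¹] := by
      ext i; fin_cases i <;> simp [h1, h2] <;> simp [hρ, hσ]
    have hw1 : FreeGroup.lift ![ρ, σ] w = 1 := by
      apply Subtype.ext
      rw [OneMemClass.coe_one, ← hw, ← e1]; rfl
    apply hw'
    rw [← e2]
    simp [hw1]

/-- The points `p`, `p'` are the fixed points of the otherwise transitive `s`, possibly equal.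
A block containing `p` is stabilized by `s`, so it consists of fixed points or it contains all
points; the former is excluded by conjugating `s` with `t`. -/
theorem isPreprimitive_genGroup (p p' : X) (ht : t * t = 1) (hp : s p = p)
    (hcyc : ∀ x y, s x ≠ x → s y ≠ y → s.SameCycle x y)
    (hfix : ∀ x, s x = x → x = p ∨ x = p')
    (hq : s (t p) ≠ t p) (hq' : s (t p') ≠ t p')
    (hpp : p ≠ p' → s (t p) = t p' ∧ s (t p') ≠ t p) :
    MulAction.IsPreprimitive (genGroup s t) X := by
  have htt (x : X) : t (t x) = x := by rw [← Perm.mul_apply, ht]; rfl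
  have htrans : MulAction.IsPretransitive (genGroup s t) X := by
    refine (MulAction.isPretransitive_iff_base p).2 fun x => ?_
    have hmoved : ∀ y, s y ≠ y → ∃ g : genGroup s t, g • p = y := by
      intro y hy
      obtain ⟨i, hi⟩ := hcyc _ _ hq hy
      exact ⟨⟨s, s_mem_genGroup⟩ ^ i * ⟨t, t_mem_genGroup⟩, hi⟩
    by_cases hx : s x = x
    · rcases hfix x hx with rfl | rfl
      · exact ⟨1, one_smul _ _⟩
      · obtain ⟨g, hg⟩ := hmoved _ hq'
        refine ⟨⟨t, t_mem_genGroup⟩ * g, ?_⟩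
        rw [mul_smul, hg]
        exact htt x
    · exact hmoved x hx
  refine MulAction.IsPreprimitive.of_isTrivialBlock_base p fun {B} hpB hB => ?_
  have hstab {g : Perm X} (hg : g ∈ genGroup s t) {x y : X} (hx : x ∈ B) (hgx : g x ∈ B)
      (hy : y ∈ B) : g y ∈ B := by
    have h : (⟨g, hg⟩ : genGroup s t) • B = B := hB.smul_eq_of_mem hx hgx
    rw [← h]
    exact Set.smul_mem_smul_set hy
  by_cases hx : ∃ x ∈ B, s x ≠ x
  · right
    obtain ⟨x, hxB, hx⟩ := hx
    have hmoved : ∀ y, s y ≠ y → y ∈ B := by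
      intro y hy
      obtain ⟨i, rfl⟩ := hcyc _ _ hx hy
      refine hstab (zpow_mem s_mem_genGroup i) hpB ?_ hxB
      rwa [Perm.zpow_apply_eq_self_of_apply_eq_self hp]
    refine Set.eq_univ_of_forall fun y => ?_
    by_cases hy : s y = y
    · rcases hfix y hy with rfl | rfl
      · exact hpB
      · have := hstab t_mem_genGroup hpB (hmoved _ hq) (hmoved _ hq')
        rwa [htt] at this
    · exact hmoved y hy
  · left
    push Not at hx
    have hsub : ∀ x ∈ B, x = p := by
      intro x hxB
      rcases hfix x (hx x hxB) with rfl | rfl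
      · rfl
      by_contra hne
      obtain ⟨h1, h2⟩ := hpp (Ne.symm hne)
      -- `t * s * t` maps the point `p` of `B` to the point `x` of `B`, so it maps `x` into `B`.
      have hg : t * s * t ∈ genGroup s t :=
        mul_mem (mul_mem t_mem_genGroup s_mem_genGroup) t_mem_genGroup
      have hmem : t (s (t x)) ∈ B := by
        refine hstab hg hpB ?_ hxB
        rwa [Perm.mul_apply, Perm.mul_apply, h1, htt]
      rcases hfix _ (hx _ hmem) with h | h
      · exact h2 (by rw [← h, htt])
      · exact hq' (by conv_rhs => rw [← h, htt])
    exact fun x hx y hy => (hsub x hx).trans (hsub y hy).symm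

end PermMap

/-! ### Cycles given by lists -/

section FormPerm

variable {X : Type*} [DecidableEq X]

theorem formPerm_apply_of_getElem? {l : List X} (hl : l.Nodup) {i k : ℕ} {x y : X}
    (hx : l[i]? = some x) (hy : l[k]? = some y) (hk : k = i + 1) : l.formPerm x = y := by
  subst hk
  obtain ⟨h1, rfl⟩ := List.getElem?_eq_some_iff.1 hx
  obtain ⟨h2, rfl⟩ := List.getElem?_eq_some_iff.1 hy
  exact List.formPerm_apply_lt_getElem l hl i h2

theorem formPerm_apply_last {l : List X} {i : ℕ} {x y : X}
    (hx : l[i]? = some x) (hy : l[0]? = some y) (hi : i + 1 = l.length) : l.formPerm x = y := by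
  obtain ⟨h1, rfl⟩ := List.getElem?_eq_some_iff.1 hx
  match l, hy with
  | z :: l, hy =>
    simp only [List.getElem?_cons_zero, Option.some.injEq] at hy
    subst hy
    have : i = l.length := by simpa using hi
    subst this
    exact List.formPerm_apply_getElem_length z l

theorem formPerm_apply_eq_self_iff_notMem {l : List X} (hl : l.Nodup) (hl' : 2 ≤ l.length) (x : X) :
    l.formPerm x = x ↔ x ∉ l := by
  refine ⟨fun h hx => ?_, List.formPerm_apply_of_notMem⟩
  have := (List.formPerm_apply_mem_eq_self_iff _ hl x hx).1 h
  omega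

theorem orderOf_formPerm [Fintype X] {l : List X} (hl : l.Nodup) (hl' : 2 ≤ l.length) :
    orderOf l.formPerm = l.length := by
  rw [(List.isCycle_formPerm hl hl').orderOf, List.support_formPerm_of_nodup _ hl,
    List.toFinset_card_of_nodup hl]
  rintro x rfl
  simp at hl'

theorem sign_formPerm_of_odd [Fintype X] {l : List X} (hl : l.Nodup) (hl' : 2 ≤ l.length)
    (h : Odd l.length) : Perm.sign l.formPerm = 1 := by
  have hc := List.isCycle_formPerm hl hl'
  rw [hc.sign, ← hc.orderOf, orderOf_formPerm hl hl', h.neg_one_pow, neg_neg]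

end FormPerm

/-! ### Generalities on the face rotation -/

theorem rPerm_apply {X : Type*} {s t : Perm X} {x y : X} (h : s y = t x) : rPerm s t x = y := by
  rw [rPerm, Perm.mul_apply, Perm.inv_eq_iff_eq, h]

theorem orderOf_eq_six {G : Type*} [Group G] {g : G} (h2 : g ^ 2 ≠ 1) (h3 : g ^ 3 ≠ 1)
    (h6 : (g ^ 2) ^ 3 = 1) : orderOf g = 6 := by
  refine orderOf_eq_of_pow_and_pow_div_prime (by norm_num) (by rw [← h6, ← pow_mul])
    fun p hp hp6 => ?_
  have : p ∈ Nat.primeFactors 6 := Nat.mem_primeFactors.2 ⟨hp, hp6, by norm_num⟩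
  rw [show Nat.primeFactors 6 = {2, 3} by decide +kernel] at this
  simp only [Finset.mem_insert, Finset.mem_singleton] at this
  rcases this with rfl | rfl
  · exact h3
  · exact h2

/-! ### The generators for `i = -1` -/

namespace PointNeg

variable {a : ℕ}

/-- The points of the long cycle of `s`, in the order in which `s` permutes them. -/
def cycle (a : ℕ) : List (PointNeg a) :=
  List.ofFn num ++ [α, β, γ] ++ (List.ofFn num').reverse ++ [δ, ε]

theorem s_eq : s a = (cycle a).formPerm := rfl

theorem nodup_cycle : (cycle a).Nodup := by
  rw [cycle, List.nodup_append, List.nodup_append, List.nodup_append, List.nodup_reverse,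
    List.nodup_ofFn, List.nodup_ofFn]
  simp only [List.mem_append, List.mem_ofFn, List.mem_reverse]
  refine ⟨⟨⟨?_, ?_, ?_⟩, ?_, ?_⟩, ?_, ?_⟩ <;> simp [Function.Injective] <;> grind

theorem length_cycle : (cycle a).length = 4 * a + 5 := by
  simp [cycle]; ring

theorem two_le_length_cycle : 2 ≤ (cycle a).length := by
  rw [length_cycle]; omega

theorem mem_cycle (x : PointNeg a) : x ∈ cycle a ↔ x ≠ α' ∧ x ≠ β' := by
  cases x <;> simp [cycle]

theorem cycle_getElem?_num (j : Fin (2 * a)) : (cycle a)[j.val]? = some (num j) := by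
  rw [cycle, List.append_assoc, List.append_assoc, List.getElem?_append_left (by simp)]
  simp

theorem cycle_getElem?_num' (j : Fin (2 * a)) : (cycle a)[4 * a + 2 - j]? = some (num' j) := by
  rw [cycle, List.getElem?_append_left (by simp; omega), List.getElem?_append_right (by simp; omega)]
  have : 4 * a + 2 - j - (List.ofFn num ++ [α, β, γ] : List (PointNeg a)).length = 2 * a - 1 - j := by
    simp; omega
  rw [this, List.getElem?_reverse (by simp; omega)]
  simp only [List.length_ofFn, List.getElem?_ofFn]
  rw [dif_pos (by omega)]
  congr 3
  omega

theorem cycle_getElem?_mid (i : Fin 3) : (cycle a)[2 * a + i]? = some (![α, β, γ] i) := by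
  rw [cycle, List.append_assoc, List.getElem?_append_left (by simp),
    List.getElem?_append_right (by simp)]
  fin_cases i <;> simp

theorem cycle_getElem?_end (i : Fin 2) : (cycle a)[4 * a + 3 + i]? = some (![δ, ε] i) := by
  rw [cycle, List.getElem?_append_right (by simp; omega)]
  have : 4 * a + 3 + i.val - (List.ofFn num ++ [α, β, γ] ++ (List.ofFn num').reverse :
    List (PointNeg a)).length = i := by simp; omega
  rw [this]
  fin_cases i <;> simp

theorem s_num {i j : Fin (2 * a)} (h : i.val + 1 = j) : s a (num i) = num j :=
  formPerm_apply_of_getElem? nodup_cycle (cycle_getElem?_num i) (cycle_getElem?_num j) h.symm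

theorem s_num_last {j : Fin (2 * a)} (h : j.val + 1 = 2 * a) : s a (num j) = α :=
  formPerm_apply_of_getElem? nodup_cycle (cycle_getElem?_num j) (cycle_getElem?_mid 0) h.symm

theorem s_α : s a α = β :=
  formPerm_apply_of_getElem? nodup_cycle (cycle_getElem?_mid 0) (cycle_getElem?_mid 1) rfl

theorem s_β : s a β = γ :=
  formPerm_apply_of_getElem? nodup_cycle (cycle_getElem?_mid 1) (cycle_getElem?_mid 2) rfl

theorem s_γ {j : Fin (2 * a)} (h : j.val + 1 = 2 * a) : s a γ = num' j :=
  formPerm_apply_of_getElem? nodup_cycle (cycle_getElem?_mid 2) (cycle_getElem?_num' j) (by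
    simp; omega)

theorem s_num' {i j : Fin (2 * a)} (h : i.val + 1 = j) : s a (num' j) = num' i :=
  formPerm_apply_of_getElem? nodup_cycle (cycle_getElem?_num' j) (cycle_getElem?_num' i) (by omega)

theorem s_num'_first {j : Fin (2 * a)} (h : j.val = 0) : s a (num' j) = δ :=
  formPerm_apply_of_getElem? nodup_cycle (cycle_getElem?_num' j) (cycle_getElem?_end 0) (by
    simp; omega)

theorem s_δ : s a δ = ε :=
  formPerm_apply_of_getElem? nodup_cycle (cycle_getElem?_end 0) (cycle_getElem?_end 1) rfl

theorem s_ε {j : Fin (2 * a)} (h : j.val = 0) : s a ε = num j :=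
  formPerm_apply_last (cycle_getElem?_end 1) (h ▸ cycle_getElem?_num j) length_cycle.symm

theorem s_apply_eq_self_iff (x : PointNeg a) : s a x = x ↔ x = α' ∨ x = β' := by
  rw [s_eq, formPerm_apply_eq_self_iff_notMem nodup_cycle two_le_length_cycle, mem_cycle]
  tauto

theorem s_α' : s a α' = α' := (s_apply_eq_self_iff _).2 (Or.inl rfl)

theorem s_β' : s a β' = β' := (s_apply_eq_self_iff _).2 (Or.inr rfl)

theorem t_num (j : Fin (2 * a)) : t a (num j) = num' j := by
  rw [t, Perm.mul_apply, (prod_swap_apply num num' _ _ _ j).1]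
  all_goals simp [Perm.mul_apply, swap_apply_def, Function.Injective]

theorem t_num' (j : Fin (2 * a)) : t a (num' j) = num j := by
  rw [t, Perm.mul_apply, (prod_swap_apply num num' _ _ _ j).2]
  all_goals simp [Perm.mul_apply, swap_apply_def, Function.Injective]

theorem t_apply_of_ne (x : PointNeg a) (h : ∀ j, x ≠ num j) (h' : ∀ j, x ≠ num' j) :
    t a x = (swap α α' * swap β β' : Perm (PointNeg a)) x := by
  rw [t, Perm.mul_apply, prod_swap_apply_of_ne _ _ _ h h']

theorem t_α : t a α = α' := by
  rw [t_apply_of_ne] <;> simp [Perm.mul_apply, swap_apply_def]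

theorem t_α' : t a α' = α := by
  rw [t_apply_of_ne] <;> simp [Perm.mul_apply, swap_apply_def]

theorem t_β : t a β = β' := by
  rw [t_apply_of_ne] <;> simp [Perm.mul_apply, swap_apply_def]

theorem t_β' : t a β' = β := by
  rw [t_apply_of_ne] <;> simp [Perm.mul_apply, swap_apply_def]

theorem t_γ : t a γ = γ := by
  rw [t_apply_of_ne] <;> simp [Perm.mul_apply, swap_apply_def]

theorem t_δ : t a δ = δ := by
  rw [t_apply_of_ne] <;> simp [Perm.mul_apply, swap_apply_def]

theorem t_ε : t a ε = ε := by
  rw [t_apply_of_ne] <;> simp [Perm.mul_apply, swap_apply_def]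

theorem t_mul_t : t a * t a = 1 := by
  ext x
  cases x <;> simp [t_num, t_num', t_α, t_α', t_β, t_β', t_γ, t_δ, t_ε]

theorem sign_t : Perm.sign (t a) = 1 := by
  rw [t, map_mul, sign_prod_swap] <;> simp

theorem sign_s : Perm.sign (s a) = 1 :=
  sign_formPerm_of_odd nodup_cycle two_le_length_cycle
    ⟨2 * a + 2, length_cycle.trans (by ring)⟩

theorem orderOf_s : orderOf (s a) = 4 * a + 5 := by
  rw [s_eq, orderOf_formPerm nodup_cycle two_le_length_cycle, length_cycle]

theorem card : Fintype.card (PointNeg a) = 4 * a + 7 := by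
  have h : insert α' (insert β' (cycle a).toFinset) = Finset.univ := by
    ext x; simp [mem_cycle]; tauto
  rw [← Finset.card_univ, ← h, Finset.card_insert_of_notMem, Finset.card_insert_of_notMem,
    List.toFinset_card_of_nodup nodup_cycle, length_cycle] <;> simp [mem_cycle]

/-- The face rotation, in the order of composition of `rPerm`. -/
theorem isPreprimitive : MulAction.IsPreprimitive (genGroup (s a) (t a)) (PointNeg a) := by
  have hc : (s a).IsCycle := List.isCycle_formPerm nodup_cycle two_le_length_cycle
  apply isPreprimitive_genGroup α' β' t_mul_t s_α' (fun x y hx hy => hc.sameCycle hx hy)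
    (fun x => (s_apply_eq_self_iff x).1)
  all_goals simp [t_α', t_β', s_α, s_β]

/-! ### The face rotation for `i = -1` -/

/-- A word that is trivial at `(r, s)` but not at `(r⁻¹, s⁻¹)`. With `R = r ^ 2` it is the cube of a
product of three conjugates of `R` and `R⁻¹`, which all have small support. -/
def relator {G : Type*} [Group G] (ρ σ : G) : G :=
  (ρ ^ 2 * ((σ⁻¹ * ρ * σ⁻¹ * σ⁻¹) * ρ ^ 2 * (σ⁻¹ * ρ * σ⁻¹ * σ⁻¹)⁻¹) * (σ⁻¹ * (ρ ^ 2)⁻¹ * σ)) ^ 3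

theorem map_relator {G H : Type*} [Group G] [Group H] (φ : G →* H) (ρ σ : G) :
    φ (relator ρ σ) = relator (φ ρ) (φ σ) := by simp [relator]

/-- The one-step rotation about a face. -/
abbrev r (a : ℕ) : Perm (PointNeg a) := rPerm (s a) (t a)

theorem r_num {i j : Fin (2 * a)} (h : i.val + 1 = j) : r a (num i) = num' j :=
  rPerm_apply (by rw [s_num' h, t_num])

theorem r_num_last {j : Fin (2 * a)} (h : j.val + 1 = 2 * a) : r a (num j) = γ :=
  rPerm_apply (by rw [s_γ h, t_num])

theorem r_num' {i j : Fin (2 * a)} (h : i.val + 1 = j) : r a (num' j) = num i :=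
  rPerm_apply (by rw [s_num h, t_num'])

theorem r_num'_first {j : Fin (2 * a)} (h : j.val = 0) : r a (num' j) = ε :=
  rPerm_apply (by rw [s_ε h, t_num'])

theorem r_α : r a α = α' := rPerm_apply (by rw [s_α', t_α])

theorem r_α' {j : Fin (2 * a)} (h : j.val + 1 = 2 * a) : r a α' = num j :=
  rPerm_apply (by rw [s_num_last h, t_α'])

theorem r_β : r a β = β' := rPerm_apply (by rw [s_β', t_β])

theorem r_β' : r a β' = α := rPerm_apply (by rw [s_α, t_β'])

theorem r_γ : r a γ = β := rPerm_apply (by rw [s_β, t_γ])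

theorem r_δ {j : Fin (2 * a)} (h : j.val = 0) : r a δ = num' j :=
  rPerm_apply (by rw [s_num'_first h, t_δ])

theorem r_ε : r a ε = δ := rPerm_apply (by rw [s_δ, t_ε])

/-- The 2-cycles `(j, (j + 1)')` of `r` disappear in its square; the 6-cycle of `r` splits into two
3-cycles. -/
theorem r_sq {f l : Fin (2 * a)} (hf : f.val = 0) (hl : l.val + 1 = 2 * a) :
    r a ^ 2 = cyc3 (num l) β α * cyc3 (num' f) δ ε * cyc3 α' γ β' := by
  ext x
  rw [pow_two, Perm.mul_apply]
  rcases x with j | j | _ | _ | _ | _ | _ | _ | _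
  · by_cases h : j + 1 < 2 * a
    · have hj : j ≠ l := by rintro rfl; omega
      rw [r_num (j := ⟨j + 1, h⟩) rfl, r_num' rfl]
      simp [cyc3, swap_apply_def, hj]
    · have hj : j = l := by ext; omega
      subst hj
      rw [r_num_last hl, r_γ]
      simp [cyc3, swap_apply_def]
  · by_cases h : j.val = 0
    · have hj : j = f := by ext; omega
      subst hj
      rw [r_num'_first hf, r_ε]
      simp [cyc3, swap_apply_def]
    · have hj : j ≠ f := by rintro rfl; omega
      have hi : (⟨j - 1, by omega⟩ : Fin (2 * a)).val + 1 = j := Nat.sub_add_cancel (by omega)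
      rw [r_num' hi, r_num hi]
      simp [cyc3, swap_apply_def, hj]
  · simp [r_α, r_α' hl, cyc3, swap_apply_def]
  · simp [r_α' hl, r_num_last hl, cyc3, swap_apply_def]
  · simp [r_β, r_β', cyc3, swap_apply_def]
  · simp [r_β', r_α, cyc3, swap_apply_def]
  · simp [r_γ, r_β, cyc3, swap_apply_def]
  · simp [r_δ hf, r_num'_first hf, cyc3, swap_apply_def]
  · simp [r_ε, r_δ hf, cyc3, swap_apply_def]

theorem s_mul_r_sq_mul_inv {f l : Fin (2 * a)} (hf : f.val = 0) (hl : l.val + 1 = 2 * a) :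
    s a * r a ^ 2 * (s a)⁻¹ = cyc3 α γ β * cyc3 δ ε (num f) * cyc3 α' (num' l) β' := by
  simp only [r_sq hf hl, ← conj_mul, conj_cyc3, s_num_last hl, s_β, s_α,
    s_num'_first hf, s_δ, s_ε hf, s_α', s_γ hl, s_β']

theorem s_inv_mul_r_sq_mul {f f₂ l₂ l : Fin (2 * a)} (hf : f.val = 0) (hf₂ : f.val + 1 = f₂)
    (hl₂ : l₂.val + 1 = l) (hl : l.val + 1 = 2 * a) :
    (s a)⁻¹ * r a ^ 2 * s a =
      cyc3 (num l₂) α (num l) * cyc3 (num' f₂) (num' f) δ * cyc3 α' β β' := by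
  have h : r a ^ 2 = s a * (cyc3 (num l₂) α (num l) * cyc3 (num' f₂) (num' f) δ * cyc3 α' β β') *
      (s a)⁻¹ := by
    simp only [r_sq hf hl, ← conj_mul, conj_cyc3, s_num hl₂, s_num_last hl, s_α, s_num' hf₂,
      s_num'_first hf, s_δ, s_α', s_β, s_β']
  rw [h]; group

/-- The middle factor of `relator (r a) (s a)`. For `a = 1` there is no third index `f₃`,
and the formula fails. -/
theorem inv_conj_r_sq {f f₂ f₃ l₂ l : Fin (2 * a)} (hf : f.val = 0) (hf₂ : f.val + 1 = f₂)
    (hf₃ : f₂.val + 1 = f₃) (hl₂ : l₂.val + 1 = l) (hl : l.val + 1 = 2 * a) (ha : 2 ≤ a) :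
    ((s a)⁻¹ * r a * (s a)⁻¹ * (s a)⁻¹) * r a ^ 2 * ((s a)⁻¹ * r a * (s a)⁻¹ * (s a)⁻¹)⁻¹ =
      cyc3 (num' l) β γ * cyc3 (num f) ε δ * cyc3 (num l₂) α' (num l) := by
  have i1 : (s a)⁻¹ α = num l := Perm.inv_eq_iff_eq.2 (s_num_last hl).symm
  have i2 : (s a)⁻¹ (num l) = num l₂ := Perm.inv_eq_iff_eq.2 (s_num hl₂).symm
  obtain ⟨l₃, hl₃⟩ : ∃ l₃ : Fin (2 * a), l₃.val + 1 = l₂ := ⟨⟨l₂ - 1, by omega⟩, by simp; omega⟩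
  have i3 : (s a)⁻¹ (num l₂) = num l₃ := Perm.inv_eq_iff_eq.2 (s_num hl₃).symm
  have i4 : (s a)⁻¹ (num' l₂) = num' l := Perm.inv_eq_iff_eq.2 (s_num' hl₂).symm
  have i5 : (s a)⁻¹ (num' l) = γ := Perm.inv_eq_iff_eq.2 (s_γ hl).symm
  have i6 : (s a)⁻¹ γ = β := Perm.inv_eq_iff_eq.2 s_β.symm
  have i7 : (s a)⁻¹ β = α := Perm.inv_eq_iff_eq.2 s_α.symm
  have i8 : (s a)⁻¹ (num' f) = num' f₂ := Perm.inv_eq_iff_eq.2 (s_num' hf₂).symm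
  have i9 : (s a)⁻¹ (num' f₂) = num' f₃ := Perm.inv_eq_iff_eq.2 (s_num' hf₃).symm
  have i10 : (s a)⁻¹ (num f₂) = num f := Perm.inv_eq_iff_eq.2 (s_num hf₂).symm
  have i11 : (s a)⁻¹ (num f) = ε := Perm.inv_eq_iff_eq.2 (s_ε hf).symm
  have i12 : (s a)⁻¹ ε = δ := Perm.inv_eq_iff_eq.2 s_δ.symm
  have i13 : (s a)⁻¹ δ = num' f := Perm.inv_eq_iff_eq.2 (s_num'_first hf).symm
  have i14 : (s a)⁻¹ α' = α' := Perm.inv_eq_iff_eq.2 s_α'.symm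
  have i15 : (s a)⁻¹ β' = β' := Perm.inv_eq_iff_eq.2 s_β'.symm
  rw [r_sq hf hl, ← conj_mul, ← conj_mul, conj_cyc3, conj_cyc3, conj_cyc3]
  simp only [Perm.mul_apply, i1, i2, i3, i4, i5, i6, i7, i8, i9, i10, i11, i12, i13, i14, i15,
    r_num hl₃, r_num hl₂, r_num_last hl, r_num' hf₃, r_num' hf₂, r_num'_first hf, r_α' hl, r_α, r_β']

/-- The inverse of the middle factor of `relator (r a)⁻¹ (s a)⁻¹`. -/
theorem conj_r_sq {f f₂ f₃ l₂ l : Fin (2 * a)} (hf : f.val = 0) (hf₂ : f.val + 1 = f₂)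
    (hf₃ : f₂.val + 1 = f₃) (hl₂ : l₂.val + 1 = l) (hl : l.val + 1 = 2 * a) (ha : 2 ≤ a) :
    (s a * (r a)⁻¹ * s a * s a) * r a ^ 2 * (s a * (r a)⁻¹ * s a * s a)⁻¹ =
      cyc3 (num' l) (num l) α * cyc3 δ (num' f) (num' f₂) * cyc3 β (num l₂) γ := by
  obtain ⟨l₃, hl₃⟩ : ∃ l₃ : Fin (2 * a), l₃.val + 1 = l₂ := ⟨⟨l₂ - 1, by omega⟩, by simp; omega⟩
  have i1 : (r a)⁻¹ γ = num l := Perm.inv_eq_iff_eq.2 (r_num_last hl).symm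
  have i2 : (r a)⁻¹ (num' l) = num l₂ := Perm.inv_eq_iff_eq.2 (r_num hl₂).symm
  have i3 : (r a)⁻¹ ε = num' f := Perm.inv_eq_iff_eq.2 (r_num'_first hf).symm
  have i4 : (r a)⁻¹ (num f) = num' f₂ := Perm.inv_eq_iff_eq.2 (r_num' hf₂).symm
  have i5 : (r a)⁻¹ (num f₂) = num' f₃ := Perm.inv_eq_iff_eq.2 (r_num' hf₃).symm
  have i6 : (r a)⁻¹ α' = α := Perm.inv_eq_iff_eq.2 r_α.symm
  have i7 : (r a)⁻¹ (num' l₂) = num l₃ := Perm.inv_eq_iff_eq.2 (r_num hl₃).symm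
  have i9 : (r a)⁻¹ β = γ := Perm.inv_eq_iff_eq.2 r_γ.symm
  have i8 : (r a)⁻¹ β' = β := Perm.inv_eq_iff_eq.2 r_β.symm
  rw [r_sq hf hl, ← conj_mul, ← conj_mul, conj_cyc3, conj_cyc3, conj_cyc3]
  simp only [Perm.mul_apply, i1, i2, i3, i4, i5, i6, i7, i8, i9, s_num_last hl, s_α, s_β, s_γ hl,
    s_num'_first hf, s_δ, s_ε hf, s_num hf₂, s_num' hf₂, s_num' hf₃, s_α', s_β', s_num hl₃,
    s_num' hl₂, s_num hl₂]

/-- The points moved by the factors of the relator; `f`, `f₂`, `l₂`, `l` stand for the first, second,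
last but one and last index. -/
def label (f f₂ l₂ l : Fin (2 * a)) : Fin 13 → PointNeg a :=
  ![num f, num' f, num' f₂, num l₂, num l, num' l, α, α', β, β', γ, δ, ε]

theorem label_injective {f f₂ l₂ l : Fin (2 * a)} (h1 : f ≠ l₂) (h2 : f ≠ l) (h3 : l₂ ≠ l)
    (h4 : f ≠ f₂) (h5 : f₂ ≠ l) : Function.Injective (label f f₂ l₂ l) := by
  rw [← List.nodup_ofFn]
  simp [label, *]

/-! ### The alternating group and the relator for `i = -1` -/

theorem exists_label (ha : 1 ≤ a) : ∃ f f₂ l₂ l : Fin (2 * a), f.val = 0 ∧ f.val + 1 = f₂ ∧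
    l₂.val + 1 = l ∧ l.val + 1 = 2 * a :=
  ⟨⟨0, by omega⟩, ⟨1, by omega⟩, ⟨2 * a - 2, by omega⟩, ⟨2 * a - 1, by omega⟩, rfl, rfl,
    by simp; omega, by simp; omega⟩

theorem r_sq_pow_three (ha : 1 ≤ a) : (r a ^ 2) ^ 3 = 1 := by
  obtain ⟨f, f₂, l₂, l, hf, hf₂, hl₂, hl⟩ := exists_label ha
  have hι : Function.Injective ![num l, β, α, num' f, δ, ε, α', γ, β'] := by
    rw [← List.nodup_ofFn]
    simp
  have h : r a ^ 2 = Perm.viaEmbeddingHom ⟨_, hι⟩ (cyc3 0 1 2 * cyc3 3 4 5 * cyc3 6 7 8) := by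
    simp only [map_mul, viaEmbedding_cyc3]
    exact r_sq hf hl
  rw [h, ← map_pow, show (cyc3 0 1 2 * cyc3 3 4 5 * cyc3 6 7 8 : Perm (Fin 9)) ^ 3 = 1 by
    decide +kernel, map_one]

theorem orderOf_r (ha : 1 ≤ a) : orderOf (r a) = 6 := by
  apply orderOf_eq_six _ _ (r_sq_pow_three ha) <;> intro h
  · have := DFunLike.congr_fun h γ
    rw [pow_two, Perm.mul_apply, r_γ, r_β] at this
    cases this
  · have := DFunLike.congr_fun h γ
    rw [pow_three, Perm.mul_apply, Perm.mul_apply, r_γ, r_β, r_β'] at this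
    cases this

theorem genGroup_eq (ha : 1 ≤ a) : genGroup (s a) (t a) = alternatingGroup (PointNeg a) := by
  refine le_antisymm (genGroup_le_alternatingGroup sign_s sign_t) ?_
  obtain ⟨f, f₂, l₂, l, hf, hf₂, hl₂, hl⟩ := exists_label ha
  have hfl : f ≠ l := by rintro rfl; omega
  have hι : Function.Injective ![num f, num' f, num l, num' l, α, α', β, β', γ, δ, ε] := by
    rw [← List.nodup_ofFn]
    simp [hfl]
  -- The product of `r ^ 2` and its conjugate by `s` is a 3-cycle times four transpositions.
  have hw : (r a ^ 2 * (s a * r a ^ 2 * (s a)⁻¹)) ^ 2 = cyc3 α γ β' := by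
    have h : r a ^ 2 * (s a * r a ^ 2 * (s a)⁻¹) = Perm.viaEmbeddingHom ⟨_, hι⟩
        (cyc3 2 6 4 * cyc3 1 9 10 * cyc3 5 8 7 * (cyc3 4 8 6 * cyc3 9 10 0 * cyc3 5 3 7)) := by
      rw [r_sq hf hl]
      simp only [← conj_mul, conj_cyc3, map_mul, viaEmbedding_cyc3, s_num_last hl, s_β, s_α,
        s_num'_first hf, s_δ, s_ε hf, s_α', s_γ hl, s_β']
      rfl
    rw [h, ← map_pow, show (cyc3 2 6 4 * cyc3 1 9 10 * cyc3 5 8 7 *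
      (cyc3 4 8 6 * cyc3 9 10 0 * cyc3 5 3 7) : Perm (Fin 11)) ^ 2 = cyc3 4 8 7 by decide +kernel,
      viaEmbedding_cyc3]
    rfl
  refine Perm.alternatingGroup_le_of_isPreprimitive_of_isThreeCycle_mem isPreprimitive
    (isThreeCycle_cyc3 (x := α) (y := γ) (z := β') (by simp) (by simp) (by simp)) ?_
  rw [← hw]
  have hr : r a ∈ genGroup (s a) (t a) := rPerm_mem_genGroup
  have hs : s a ∈ genGroup (s a) (t a) := s_mem_genGroup
  exact pow_mem (mul_mem (pow_mem hr 2) (mul_mem (mul_mem hs (pow_mem hr 2)) (inv_mem hs))) 2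

theorem relator_eq_one (ha : 1 ≤ a) : relator (r a) (s a) = 1 := by
  obtain rfl | ha2 : a = 1 ∨ 2 ≤ a := by omega
  · -- Some of the points of `label` coincide.
    have : ∀ x, relator (r 1) (s 1) x = x := by decide +kernel
    ext x; exact this x
  obtain ⟨f, f₂, l₂, l, hf, hf₂, hl₂, hl⟩ := exists_label ha
  obtain ⟨f₃, hf₃⟩ : ∃ f₃ : Fin (2 * a), f₂.val + 1 = f₃ := ⟨⟨f₂ + 1, by omega⟩, rfl⟩
  have hι : Function.Injective (label f f₂ l₂ l) := by
    apply label_injective <;> rintro rfl <;> omega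
  have hB : (s a)⁻¹ * (r a ^ 2)⁻¹ * s a = ((s a)⁻¹ * r a ^ 2 * s a)⁻¹ := by group
  rw [relator, hB, inv_conj_r_sq hf hf₂ hf₃ hl₂ hl ha2,
    s_inv_mul_r_sq_mul hf hf₂ hl₂ hl, r_sq hf hl]
  have h : cyc3 (num l) β α * cyc3 (num' f) δ ε * cyc3 α' γ β' *
      (cyc3 (num' l) β γ * cyc3 (num f) ε δ * cyc3 (num l₂) α' (num l)) *
      (cyc3 (num l₂) α (num l) * cyc3 (num' f₂) (num' f) δ * cyc3 α' β β')⁻¹ =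
      Perm.viaEmbeddingHom ⟨_, hι⟩ (cyc3 4 8 6 * cyc3 1 11 12 * cyc3 7 10 9 *
        (cyc3 5 8 10 * cyc3 0 12 11 * cyc3 3 7 4) *
        (cyc3 3 6 4 * cyc3 2 1 11 * cyc3 7 8 9)⁻¹) := by
    simp only [map_mul, map_inv, viaEmbedding_cyc3]
    rfl
  rw [h, ← map_pow, show (cyc3 4 8 6 * cyc3 1 11 12 * cyc3 7 10 9 *
        (cyc3 5 8 10 * cyc3 0 12 11 * cyc3 3 7 4) *
        (cyc3 3 6 4 * cyc3 2 1 11 * cyc3 7 8 9)⁻¹ : Perm (Fin 13)) ^ 3 = 1 by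
      decide +kernel, map_one]

/-- In the inverse form of the relator the product of the three factors contains a 7-cycle, so that
its cube is not trivial. -/
theorem relator_inv_ne_one (ha : 1 ≤ a) : relator (r a)⁻¹ (s a)⁻¹ ≠ 1 := by
  obtain rfl | ha2 : a = 1 ∨ 2 ≤ a := by omega
  · intro h
    have : ∃ x, relator (r 1)⁻¹ (s 1)⁻¹ x ≠ x := by decide +kernel
    rw [h] at this
    simp at this
  obtain ⟨f, f₂, l₂, l, hf, hf₂, hl₂, hl⟩ := exists_label ha
  obtain ⟨f₃, hf₃⟩ : ∃ f₃ : Fin (2 * a), f₂.val + 1 = f₃ := ⟨⟨f₂ + 1, by omega⟩, rfl⟩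
  have hι : Function.Injective (label f f₂ l₂ l) := by
    apply label_injective <;> rintro rfl <;> omega
  have h1 : relator (r a)⁻¹ (s a)⁻¹ = ((r a ^ 2)⁻¹ * ((s a * (r a)⁻¹ * s a * s a) * r a ^ 2 *
      (s a * (r a)⁻¹ * s a * s a)⁻¹)⁻¹ * (s a * r a ^ 2 * (s a)⁻¹)) ^ 3 := by
    simp only [relator, inv_pow, mul_inv_rev, inv_inv, mul_assoc]
  rw [h1, conj_r_sq hf hf₂ hf₃ hl₂ hl ha2, s_mul_r_sq_mul_inv hf hl, r_sq hf hl]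
  have h : (cyc3 (num l) β α * cyc3 (num' f) δ ε * cyc3 α' γ β')⁻¹ *
      (cyc3 (num' l) (num l) α * cyc3 δ (num' f) (num' f₂) * cyc3 β (num l₂) γ)⁻¹ *
      (cyc3 α γ β * cyc3 δ ε (num f) * cyc3 α' (num' l) β') =
      Perm.viaEmbeddingHom ⟨_, hι⟩ ((cyc3 4 8 6 * cyc3 1 11 12 * cyc3 7 10 9)⁻¹ *
        (cyc3 5 4 6 * cyc3 11 1 2 * cyc3 8 3 10)⁻¹ *
        (cyc3 6 10 8 * cyc3 11 12 0 * cyc3 7 5 9)) := by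
    simp only [map_mul, map_inv, viaEmbedding_cyc3]
    rfl
  rw [h, ← map_pow]
  refine (map_ne_one_iff _ (Perm.viaEmbeddingHom_injective _)).2 ?_
  decide +kernel

end PointNeg

/-! ### The generators for `i = 1` -/

namespace PointPos

variable {a : ℕ}

/-- The points of the long cycle of `s`, in the order in which `s` permutes them. -/
def cycle (a : ℕ) : List (PointPos a) :=
  List.ofFn num ++ [α, β, β', γ, δ, γ', α'] ++ (List.ofFn num').reverse

theorem s_eq : s a = (cycle a).formPerm := rfl

theorem nodup_cycle : (cycle a).Nodup := by
  rw [cycle, List.nodup_append, List.nodup_append, List.nodup_reverse,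
    List.nodup_ofFn, List.nodup_ofFn]
  simp only [List.mem_append, List.mem_ofFn, List.mem_reverse]
  refine ⟨⟨?_, ?_, ?_⟩, ?_, ?_⟩ <;> simp [Function.Injective]
  grind

theorem length_cycle : (cycle a).length = 4 * a + 7 := by
  simp [cycle]; ring

theorem two_le_length_cycle : 2 ≤ (cycle a).length := by
  rw [length_cycle]; omega

theorem mem_cycle (x : PointPos a) : x ∈ cycle a ↔ x ≠ δ' := by
  cases x <;> simp [cycle]

theorem cycle_getElem?_num (j : Fin (2 * a)) : (cycle a)[j.val]? = some (num j) := by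
  rw [cycle, List.append_assoc, List.getElem?_append_left (by simp)]
  simp

theorem cycle_getElem?_num' (j : Fin (2 * a)) : (cycle a)[4 * a + 6 - j]? = some (num' j) := by
  rw [cycle, List.getElem?_append_right (by simp; omega)]
  have : 4 * a + 6 - j - (List.ofFn num ++ [α, β, β', γ, δ, γ', α'] : List (PointPos a)).length =
      2 * a - 1 - j := by
    simp; omega
  rw [this, List.getElem?_reverse (by simp; omega)]
  simp only [List.length_ofFn, List.getElem?_ofFn]
  rw [dif_pos (by omega)]
  congr 3
  omega

theorem cycle_getElem?_mid (i : Fin 7) :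
    (cycle a)[2 * a + i]? = some (![α, β, β', γ, δ, γ', α'] i) := by
  rw [cycle, List.getElem?_append_left (by simp), List.getElem?_append_right (by simp)]
  fin_cases i <;> simp

theorem s_num {i j : Fin (2 * a)} (h : i.val + 1 = j) : s a (num i) = num j :=
  formPerm_apply_of_getElem? nodup_cycle (cycle_getElem?_num i) (cycle_getElem?_num j) h.symm

theorem s_num_last {j : Fin (2 * a)} (h : j.val + 1 = 2 * a) : s a (num j) = α :=
  formPerm_apply_of_getElem? nodup_cycle (cycle_getElem?_num j) (cycle_getElem?_mid 0) h.symm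

theorem s_α : s a α = β :=
  formPerm_apply_of_getElem? nodup_cycle (cycle_getElem?_mid 0) (cycle_getElem?_mid 1) rfl

theorem s_β : s a β = β' :=
  formPerm_apply_of_getElem? nodup_cycle (cycle_getElem?_mid 1) (cycle_getElem?_mid 2) rfl

theorem s_β' : s a β' = γ :=
  formPerm_apply_of_getElem? nodup_cycle (cycle_getElem?_mid 2) (cycle_getElem?_mid 3) rfl

theorem s_γ : s a γ = δ :=
  formPerm_apply_of_getElem? nodup_cycle (cycle_getElem?_mid 3) (cycle_getElem?_mid 4) rfl

theorem s_δ : s a δ = γ' :=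
  formPerm_apply_of_getElem? nodup_cycle (cycle_getElem?_mid 4) (cycle_getElem?_mid 5) rfl

theorem s_γ' : s a γ' = α' :=
  formPerm_apply_of_getElem? nodup_cycle (cycle_getElem?_mid 5) (cycle_getElem?_mid 6) rfl

theorem s_α' {j : Fin (2 * a)} (h : j.val + 1 = 2 * a) : s a α' = num' j :=
  formPerm_apply_of_getElem? nodup_cycle (cycle_getElem?_mid 6) (cycle_getElem?_num' j) (by
    simp; omega)

theorem s_num' {i j : Fin (2 * a)} (h : i.val + 1 = j) : s a (num' j) = num' i :=
  formPerm_apply_of_getElem? nodup_cycle (cycle_getElem?_num' j) (cycle_getElem?_num' i) (by omega)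

theorem s_num'_first {j : Fin (2 * a)} (h : j.val = 0) : s a (num' j) = num j :=
  formPerm_apply_last (cycle_getElem?_num' j) (h ▸ cycle_getElem?_num j) (by
    have := length_cycle (a := a)
    rw [cycle] at this
    omega)

theorem s_apply_eq_self_iff (x : PointPos a) : s a x = x ↔ x = δ' := by
  rw [s_eq, formPerm_apply_eq_self_iff_notMem nodup_cycle two_le_length_cycle, mem_cycle, not_not]

theorem s_δ' : s a δ' = δ' := (s_apply_eq_self_iff _).2 rfl

theorem t_num (j : Fin (2 * a)) : t a (num j) = num' j := by
  rw [t, Perm.mul_apply, (prod_swap_apply num num' _ _ _ j).1]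
  all_goals simp [Perm.mul_apply, swap_apply_def, Function.Injective]

theorem t_num' (j : Fin (2 * a)) : t a (num' j) = num j := by
  rw [t, Perm.mul_apply, (prod_swap_apply num num' _ _ _ j).2]
  all_goals simp [Perm.mul_apply, swap_apply_def, Function.Injective]

theorem t_apply_of_ne (x : PointPos a) (h : ∀ j, x ≠ num j) (h' : ∀ j, x ≠ num' j) :
    t a x = (swap α α' * swap β β' * (swap γ γ' * swap δ δ') : Perm (PointPos a)) x := by
  rw [t, Perm.mul_apply, prod_swap_apply_of_ne _ _ _ h h']

theorem t_α : t a α = α' := by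
  rw [t_apply_of_ne] <;> simp [Perm.mul_apply, swap_apply_def]

theorem t_α' : t a α' = α := by
  rw [t_apply_of_ne] <;> simp [Perm.mul_apply, swap_apply_def]

theorem t_β : t a β = β' := by
  rw [t_apply_of_ne] <;> simp [Perm.mul_apply, swap_apply_def]

theorem t_β' : t a β' = β := by
  rw [t_apply_of_ne] <;> simp [Perm.mul_apply, swap_apply_def]

theorem t_γ : t a γ = γ' := by
  rw [t_apply_of_ne] <;> simp [Perm.mul_apply, swap_apply_def]

theorem t_γ' : t a γ' = γ := by
  rw [t_apply_of_ne] <;> simp [Perm.mul_apply, swap_apply_def]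

theorem t_δ : t a δ = δ' := by
  rw [t_apply_of_ne] <;> simp [Perm.mul_apply, swap_apply_def]

theorem t_δ' : t a δ' = δ := by
  rw [t_apply_of_ne] <;> simp [Perm.mul_apply, swap_apply_def]

theorem t_mul_t : t a * t a = 1 := by
  ext x
  cases x <;> simp [t_num, t_num', t_α, t_α', t_β, t_β', t_γ, t_γ', t_δ, t_δ']

theorem sign_t : Perm.sign (t a) = 1 := by
  rw [t, map_mul, sign_prod_swap] <;> simp

theorem sign_s : Perm.sign (s a) = 1 :=
  sign_formPerm_of_odd nodup_cycle two_le_length_cycle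
    ⟨2 * a + 3, length_cycle.trans (by ring)⟩

theorem orderOf_s : orderOf (s a) = 4 * a + 7 := by
  rw [s_eq, orderOf_formPerm nodup_cycle two_le_length_cycle, length_cycle]

theorem card : Fintype.card (PointPos a) = 4 * a + 8 := by
  have h : insert δ' (cycle a).toFinset = Finset.univ := by
    ext x; simp [mem_cycle]; tauto
  rw [← Finset.card_univ, ← h, Finset.card_insert_of_notMem,
    List.toFinset_card_of_nodup nodup_cycle, length_cycle]
  simp [mem_cycle]

theorem isPreprimitive : MulAction.IsPreprimitive (genGroup (s a) (t a)) (PointPos a) := by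
  have hc : (s a).IsCycle := List.isCycle_formPerm nodup_cycle two_le_length_cycle
  apply isPreprimitive_genGroup δ' δ' t_mul_t s_δ' (fun x y hx hy => hc.sameCycle hx hy)
    (fun x hx => Or.inl ((s_apply_eq_self_iff x).1 hx))
  all_goals simp [t_δ', s_δ]

/-! ### The face rotation for `i = 1` -/

/-- A word that is trivial at `(r, s)` but not at `(r⁻¹, s⁻¹)`. -/
def relator {G : Type*} [Group G] (ρ σ : G) : G :=
  (ρ ^ 2 * (σ⁻¹ * ρ ^ 2 * σ)⁻¹ * (σ * ρ ^ 2 * σ⁻¹)) ^ 3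

theorem map_relator {G H : Type*} [Group G] [Group H] (φ : G →* H) (ρ σ : G) :
    φ (relator ρ σ) = relator (φ ρ) (φ σ) := by simp [relator]

/-- The one-step rotation about a face. -/
abbrev r (a : ℕ) : Perm (PointPos a) := rPerm (s a) (t a)

theorem r_num {i j : Fin (2 * a)} (h : i.val + 1 = j) : r a (num i) = num' j :=
  rPerm_apply (by rw [s_num' h, t_num])

theorem r_num_last {j : Fin (2 * a)} (h : j.val + 1 = 2 * a) : r a (num j) = α' :=
  rPerm_apply (by rw [s_α' h, t_num])

theorem r_num' {i j : Fin (2 * a)} (h : i.val + 1 = j) : r a (num' j) = num i :=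
  rPerm_apply (by rw [s_num h, t_num'])

theorem r_num'_first {j : Fin (2 * a)} (h : j.val = 0) : r a (num' j) = num' j :=
  rPerm_apply (by rw [s_num'_first h, t_num'])

theorem r_α : r a α = γ' := rPerm_apply (by rw [s_γ', t_α])

theorem r_α' {j : Fin (2 * a)} (h : j.val + 1 = 2 * a) : r a α' = num j :=
  rPerm_apply (by rw [s_num_last h, t_α'])

theorem r_β : r a β = β := rPerm_apply (by rw [s_β, t_β])

theorem r_β' : r a β' = α := rPerm_apply (by rw [s_α, t_β'])

theorem r_γ : r a γ = δ := rPerm_apply (by rw [s_δ, t_γ])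

theorem r_γ' : r a γ' = β' := rPerm_apply (by rw [s_β', t_γ'])

theorem r_δ : r a δ = δ' := rPerm_apply (by rw [s_δ', t_δ])

theorem r_δ' : r a δ' = γ := rPerm_apply (by rw [s_γ, t_δ'])

theorem exists_last (ha : 1 ≤ a) : ∃ l : Fin (2 * a), l.val + 1 = 2 * a :=
  ⟨⟨2 * a - 1, by omega⟩, by simp; omega⟩

/-- Besides 2-cycles and fixed points, `r` has two 3-cycles. -/
theorem r_sq (ha : 1 ≤ a) : r a ^ 2 = cyc3 α β' γ' * cyc3 γ δ' δ := by
  obtain ⟨l, hl⟩ := exists_last ha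
  ext x
  rw [pow_two, Perm.mul_apply]
  rcases x with j | j | _ | _ | _ | _ | _ | _ | _ | _
  · by_cases h : j + 1 < 2 * a
    · rw [r_num (j := ⟨j + 1, h⟩) rfl, r_num' rfl]
      simp [cyc3, swap_apply_def]
    · have hj : j.val + 1 = 2 * a := by omega
      rw [r_num_last hj, r_α' hj]
      simp [cyc3, swap_apply_def]
  · by_cases h : j.val = 0
    · rw [r_num'_first h, r_num'_first h]
      simp [cyc3, swap_apply_def]
    · have hi : (⟨j - 1, by omega⟩ : Fin (2 * a)).val + 1 = j := Nat.sub_add_cancel (by omega)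
      rw [r_num' hi, r_num hi]
      simp [cyc3, swap_apply_def]
  · simp [r_α, r_γ', cyc3, swap_apply_def]
  · simp [r_α' hl, r_num_last hl, cyc3, swap_apply_def]
  · simp [r_β, cyc3, swap_apply_def]
  · simp [r_β', r_α, cyc3, swap_apply_def]
  · simp [r_γ, r_δ, cyc3, swap_apply_def]
  · simp [r_γ', r_β', cyc3, swap_apply_def]
  · simp [r_δ, r_δ', cyc3, swap_apply_def]
  · simp [r_δ', r_γ, cyc3, swap_apply_def]

theorem s_mul_r_sq_mul_inv (ha : 1 ≤ a) :
    s a * r a ^ 2 * (s a)⁻¹ = cyc3 β γ α' * cyc3 δ δ' γ' := by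
  simp only [r_sq ha, ← conj_mul, conj_cyc3, s_α, s_β', s_γ', s_γ, s_δ', s_δ]

theorem s_inv_mul_r_sq_mul {l : Fin (2 * a)} (hl : l.val + 1 = 2 * a) (ha : 1 ≤ a) :
    (s a)⁻¹ * r a ^ 2 * s a = cyc3 (num l) β δ * cyc3 β' δ' γ := by
  have h : r a ^ 2 = s a * (cyc3 (num l) β δ * cyc3 β' δ' γ) * (s a)⁻¹ := by
    simp only [r_sq ha, ← conj_mul, conj_cyc3, s_num_last hl, s_β, s_δ, s_β', s_δ', s_γ]
  rw [h]; group

/-- The points moved by `r ^ 2` and its conjugates by `s` and `s⁻¹`; `l` stands for the last index. -/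
def label (l : Fin (2 * a)) : Fin 9 ↪ PointPos a :=
  ⟨![num l, α, α', β, β', γ, γ', δ, δ'], by rw [← List.nodup_ofFn]; simp⟩

theorem r_sq_eq_map (l : Fin (2 * a)) (ha : 1 ≤ a) :
    r a ^ 2 = Perm.viaEmbeddingHom (label l) (cyc3 1 4 6 * cyc3 5 8 7) := by
  simp only [map_mul, viaEmbedding_cyc3]
  exact r_sq ha

theorem s_mul_r_sq_mul_inv_eq_map (l : Fin (2 * a)) (ha : 1 ≤ a) :
    s a * r a ^ 2 * (s a)⁻¹ = Perm.viaEmbeddingHom (label l) (cyc3 3 5 2 * cyc3 7 8 6) := by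
  simp only [map_mul, viaEmbedding_cyc3]
  exact s_mul_r_sq_mul_inv ha

theorem s_inv_mul_r_sq_mul_eq_map {l : Fin (2 * a)} (hl : l.val + 1 = 2 * a) (ha : 1 ≤ a) :
    (s a)⁻¹ * r a ^ 2 * s a = Perm.viaEmbeddingHom (label l) (cyc3 0 3 7 * cyc3 4 8 5) := by
  simp only [map_mul, viaEmbedding_cyc3]
  exact s_inv_mul_r_sq_mul hl ha

/-! ### The alternating group and the relator for `i = 1` -/

theorem orderOf_r (ha : 1 ≤ a) : orderOf (r a) = 6 := by
  obtain ⟨l, hl⟩ := exists_last ha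
  apply orderOf_eq_six
  · intro h
    have := DFunLike.congr_fun h γ
    rw [pow_two, Perm.mul_apply, r_γ, r_δ] at this
    cases this
  · intro h
    have := DFunLike.congr_fun h α'
    rw [pow_three, Perm.mul_apply, Perm.mul_apply, r_α' hl, r_num_last hl, r_α' hl] at this
    cases this
  · rw [r_sq_eq_map l ha, ← map_pow,
      show (cyc3 1 4 6 * cyc3 5 8 7 : Perm (Fin 9)) ^ 3 = 1 by decide +kernel, map_one]

theorem genGroup_eq (ha : 1 ≤ a) : genGroup (s a) (t a) = alternatingGroup (PointPos a) := by
  refine le_antisymm (genGroup_le_alternatingGroup sign_s sign_t) ?_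
  obtain ⟨l, hl⟩ := exists_last ha
  have hw : (s a * r a ^ 2 * (s a)⁻¹)⁻¹ * (r a ^ 2 * ((s a)⁻¹ * r a ^ 2 * s a) * (r a ^ 2)⁻¹) =
      cyc3 (num l) α' γ := by
    rw [s_mul_r_sq_mul_inv_eq_map l ha, s_inv_mul_r_sq_mul_eq_map hl ha, r_sq_eq_map l ha]
    simp only [← map_mul, ← map_inv]
    rw [show (cyc3 3 5 2 * cyc3 7 8 6)⁻¹ * (cyc3 1 4 6 * cyc3 5 8 7 * (cyc3 0 3 7 * cyc3 4 8 5) *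
      (cyc3 1 4 6 * cyc3 5 8 7)⁻¹) = (cyc3 0 2 5 : Perm (Fin 9)) by decide +kernel,
      viaEmbedding_cyc3]
    rfl
  refine Perm.alternatingGroup_le_of_isPreprimitive_of_isThreeCycle_mem isPreprimitive
    (isThreeCycle_cyc3 (x := num l) (y := α') (z := γ) (by simp) (by simp) (by simp)) ?_
  rw [← hw]
  have hr : r a ^ 2 ∈ genGroup (s a) (t a) := pow_mem rPerm_mem_genGroup 2
  have hs : s a ∈ genGroup (s a) (t a) := s_mem_genGroup
  exact mul_mem (inv_mem (mul_mem (mul_mem hs hr) (inv_mem hs)))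
    (mul_mem (mul_mem hr (mul_mem (mul_mem (inv_mem hs) hr) hs)) (inv_mem hr))

theorem relator_eq_one (ha : 1 ≤ a) : relator (r a) (s a) = 1 := by
  obtain ⟨l, hl⟩ := exists_last ha
  rw [relator, s_mul_r_sq_mul_inv_eq_map l ha, s_inv_mul_r_sq_mul_eq_map hl ha, r_sq_eq_map l ha]
  simp only [← map_mul, ← map_inv, ← map_pow]
  rw [show (cyc3 1 4 6 * cyc3 5 8 7 * (cyc3 0 3 7 * cyc3 4 8 5)⁻¹ *
    (cyc3 3 5 2 * cyc3 7 8 6) : Perm (Fin 9)) ^ 3 = 1 by decide +kernel, map_one]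

/-- In the inverse form of the relator the product of the three factors contains a 5-cycle, so that
its cube is not trivial. -/
theorem relator_inv_ne_one (ha : 1 ≤ a) : relator (r a)⁻¹ (s a)⁻¹ ≠ 1 := by
  obtain ⟨l, hl⟩ := exists_last ha
  have h : relator (r a)⁻¹ (s a)⁻¹ = ((r a ^ 2)⁻¹ * (s a * r a ^ 2 * (s a)⁻¹) *
      ((s a)⁻¹ * r a ^ 2 * s a)⁻¹) ^ 3 := by
    simp only [relator, inv_pow, mul_inv_rev, inv_inv, mul_assoc]
  rw [h, s_mul_r_sq_mul_inv_eq_map l ha, s_inv_mul_r_sq_mul_eq_map hl ha, r_sq_eq_map l ha]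
  simp only [← map_mul, ← map_inv, ← map_pow]
  refine (map_ne_one_iff _ (Perm.viaEmbeddingHom_injective _)).2 ?_
  decide +kernel

end PointPos

theorem proposition3p2 (a : ℕ) (ha : 1 ≤ a) :
    (∀ n k : ℕ, n = 4 * a + 6 - 1 → k = n + 2 →
      Fintype.card (PointNeg a) = k ∧
      genGroup (PointNeg.s a) (PointNeg.t a) = alternatingGroup (PointNeg a) ∧
      (permMap (PointNeg.s a) (PointNeg.t a)).HasType 6 n ∧
      (permMap (PointNeg.s a) (PointNeg.t a)).IsChiral) ∧
    (∀ n k : ℕ, n = 4 * a + 6 + 1 → k = n + 1 →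
      Fintype.card (PointPos a) = k ∧
      genGroup (PointPos.s a) (PointPos.t a) = alternatingGroup (PointPos a) ∧
      (permMap (PointPos.s a) (PointPos.t a)).HasType 6 n ∧
      (permMap (PointPos.s a) (PointPos.t a)).IsChiral) := by
  refine ⟨fun n k hn hk => ⟨?_, PointNeg.genGroup_eq ha, ?_⟩,
    fun n k hn hk => ⟨?_, PointPos.genGroup_eq ha, ?_⟩⟩
  · rw [PointNeg.card]; omega
  · refine permMap_hasType_isChiral PointNeg.t_mul_t (fun h => ?_) (PointNeg.orderOf_r ha)
      (PointNeg.orderOf_s.trans (by omega))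
      (PointNeg.relator (FreeGroup.of 0) (FreeGroup.of 1)) ?_ ?_
    · have := PointNeg.t_α (a := a)
      rw [h] at this
      cases this
    · simpa [PointNeg.map_relator] using PointNeg.relator_eq_one ha
    · simpa [PointNeg.map_relator] using PointNeg.relator_inv_ne_one ha
  · rw [PointPos.card]; omega
  · refine permMap_hasType_isChiral PointPos.t_mul_t (fun h => ?_) (PointPos.orderOf_r ha)
      (PointPos.orderOf_s.trans (by omega))
      (PointPos.relator (FreeGroup.of 0) (FreeGroup.of 1)) ?_ ?_
    · have := PointPos.t_α (a := a)
      rw [h] at this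
      cases this
    · simpa [PointPos.map_relator] using PointPos.relator_eq_one ha
    · simpa [PointPos.map_relator] using PointPos.relator_inv_ne_one ha
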